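/- **Financial networks.** A financial network on a finite set $B$ of $n=|B|$ banks consists of external assets $e_v\ge 0$ for each $v\in B$, weights $\delta_{u,v}\ge 0$ of simple debts from debtor $u$ to creditor $v$, and weights $\delta_{u,v}^w\ge 0$ of credit default swaps from $u$ to $v$ in reference to $w$ (all real numbers), such that no bank has a contract with itself or in reference to itself ($\delta_{u,u}=0$, and $\delta^w_{u,v}=0$ unless $u,v,w$ are distinct). For a recovery rate vector $r\in[0,1]^B$ put $$l_{u,v}(r)=\delta_{u,v}+\sum_{w\in B}\delta_{u,v}^w(1-r_w),\qquad l_u(r)=\sum_{v\in B} l_{u,v}(r),\qquad a_v(r)=e_v+\sum_{u\in B} r_u\, l_{u,v}(r),$$ and let $R(a,l)=1$ if $a\ge l$ and $R(a,l)=a/l$ otherwise. **Reversible sequential model.** Initially $r_v=1$ for every $v\in B$. A bank $v$ is updatable in the state $r$ if $r_v\ne R(a_v(r),l_v(r))$. In each step one updatable bank $v$ is chosen, its rate $r_v$ is replaced by $R(a_v(r),l_v(r))$, and all other rates are kept. The process stabilizes after $T$ steps if the state reached after $T$ steps is the first in which no bank is updatable. An ordering is any sequence of choices of updatable banks, continued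 as long as there is an updatable bank. **Theorem.** There are financial networks for which every possible ordering of updates eventually stabilizes, but only after $2^{\Omega(n)}$ steps. That is, there are a constant $c>0$ and an $N\in\mathbb N$ such that for every $n\ge N$ there is a financial network with $n$ banks in which, for every ordering of updates in the reversible sequential model, the process stabilizes after some finite number $T$ of steps, and $T\ge 2^{cn}$. -/

import Mathlib

/-- A financial system on the set `B` of banks. External assets and contract weights are
nonnegative (finite) reals, a contract of weight `0` being the same as no contract. No bank has a
contract with itself or in reference to itself. -/
structure FinancialNetwork (B : Type*) where
  /-- The external assets `e_v` of the bank `v`. -/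
  extAssets : B → ℝ
  /-- `debt u v` is the weight of the simple debt with debtor `u` and creditor `v`. -/
  debt : B → B → ℝ
  /-- `cds u v w` is the weight of the credit default swap with debtor `u`, creditor `v` and
  reference entity `w`. -/
  cds : B → B → B → ℝ
  extAssets_nonneg : ∀ v, 0 ≤ extAssets v
  debt_nonneg : ∀ u v, 0 ≤ debt u v
  cds_nonneg : ∀ u v w, 0 ≤ cds u v w
  debt_self : ∀ u, debt u u = 0
  cds_debtor_eq_creditor : ∀ u w, cds u u w = 0
  cds_debtor_eq_reference : ∀ u v, cds u v u = 0
  cds_creditor_eq_reference : ∀ u v, cds u v v = 0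

namespace FinancialNetwork

/-- The recovery rate of a bank with assets `a` and liabilities `l` (where `0 ≤ a`, `0 ≤ l`). -/
noncomputable def recoveryRate (a l : ℝ) : ℝ :=
  if l ≤ a then 1 else a / l

variable {B : Type*} [Fintype B]

/-- The liability `l_{u,v}(r)` of `u` towards `v` under the recovery rate vector `r`. -/
noncomputable def liabilityTo (S : FinancialNetwork B) (r : B → ℝ) (u v : B) : ℝ :=
  S.debt u v + ∑ w, S.cds u v w * (1 - r w)

/-- The total liability `l_u(r)` of `u`. -/
noncomputable def liability (S : FinancialNetwork B) (r : B → ℝ) (u : B) : ℝ :=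
  ∑ v, S.liabilityTo r u v

/-- The payment `p_{u,v}(r)` from `u` to `v`. -/
noncomputable def payment (S : FinancialNetwork B) (r : B → ℝ) (u v : B) : ℝ :=
  r u * S.liabilityTo r u v

/-- The total assets `a_v(r)` of `v`: external assets and incoming payments. -/
noncomputable def assets (S : FinancialNetwork B) (r : B → ℝ) (v : B) : ℝ :=
  S.extAssets v + ∑ u, S.payment r u v

/-- The recovery rate `R(a_v(r), l_v(r))` that `v` announces if it updates in the state `r`. -/
noncomputable def newRate (S : FinancialNetwork B) (r : B → ℝ) (v : B) : ℝ :=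
  recoveryRate (S.assets r v) (S.liability r v)

/-- The bank `v` is updatable in the state `r`. -/
def Updatable (S : FinancialNetwork B) (r : B → ℝ) (v : B) : Prop :=
  r v ≠ S.newRate r v

/-- No bank is updatable in the state `r`. -/
def Stable (S : FinancialNetwork B) (r : B → ℝ) : Prop :=
  ∀ v, ¬ S.Updatable r v

/-- The state (vector of announced recovery rates) at time `t` when the update of time step `t + 1`
is executed by the bank `σ t`. Initially all recovery rates are `1`. (An update of a bank that is
not updatable changes nothing, so the state stays constant once it is stable.) -/
noncomputable def state [DecidableEq B] (S : FinancialNetwork B) (σ : ℕ → B) : ℕ → B → ℝ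
  | 0 => fun _ => 1
  | t + 1 => Function.update (S.state σ t) (σ t) (S.newRate (S.state σ t) (σ t))

/-- `σ` is a possible ordering of updates in the reversible sequential model: as long as there is
an updatable bank, the bank chosen for the next step is an updatable one. (The values of `σ` after
stabilization are irrelevant.) -/
def IsOrdering [DecidableEq B] (S : FinancialNetwork B) (σ : ℕ → B) : Prop :=
  ∀ t, ¬ S.Stable (S.state σ t) → S.Updatable (S.state σ t) (σ t)

/-- Under the ordering `σ`, the process stabilizes after exactly `T` steps. -/
def StabilizesAfter [DecidableEq B] (S : FinancialNetwork B) (σ : ℕ → B) (T : ℕ) : Prop :=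
  S.Stable (S.state σ T) ∧ ∀ t < T, ¬ S.Stable (S.state σ t)

end FinancialNetwork

/-!
The network is built so that at every time at most one bank is updatable. Hence there is only one
ordering, and it suffices to follow a single run (`FinancialNetwork.ForcedRun`).

The long part of the run is due to two banks `up` and `down` which owe `1` each. A bank that holds a
credit default swap of a solvent debtor in reference to `w` receives `1 - r w`; so `down` has the
rate `1 - r up`, and `up` has the rate `min 1 (ε + 1 - r down)`, where `ε` is a further payment to
`up`. Each round of two updates increases `r up` by `ε`. If `up` starts at `ε = 2 ^ (-(m + 1))` and
`down` at `1`, this lasts for `2 ^ (m + 1)` rounds and then stops, since rates are capped at `1`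
(`SlowNetwork.forcedRun_climbing`).

The payment `ε` is created from contracts of weight `1` by a chain of `m + 2` banks, each of which
passes half of its assets on (`SlowNetwork.settled_succ_mul`), except for the first, which has no
assets and starts the process by its default.

It remains to force the start, in which all rates are `1`. A bank whose liabilities are all swaps
owes nothing before a reference entity of these swaps defaults, and it keeps its rate `1` until
then. So each bank of the chain refers to its predecessor, `gate` to the last bank of the chain, `up` to
`gate`, `latch` to `up`, and `down` to `latch`. The banks `gate` and `latch` have no assets and thus
default completely as soon as they owe anything. At the end `up` returns to the rate `1`, which must
not release `latch`; therefore `latch` also refers to `down`, which is below `1` from its first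
update on.
-/

namespace FinancialNetwork

/-! ### Renaming the banks -/

section Relabel

variable {B C : Type*}

/-- The network obtained by renaming the banks along a bijection. -/
def relabel (S : FinancialNetwork B) (e : B ≃ C) : FinancialNetwork C where
  extAssets v := S.extAssets (e.symm v)
  debt u v := S.debt (e.symm u) (e.symm v)
  cds u v w := S.cds (e.symm u) (e.symm v) (e.symm w)
  extAssets_nonneg _ := S.extAssets_nonneg _
  debt_nonneg _ _ := S.debt_nonneg _ _
  cds_nonneg _ _ _ := S.cds_nonneg _ _ _
  debt_self _ := S.debt_self _
  cds_debtor_eq_creditor _ _ := S.cds_debtor_eq_creditor _ _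
  cds_debtor_eq_reference _ _ := S.cds_debtor_eq_reference _ _
  cds_creditor_eq_reference _ _ := S.cds_creditor_eq_reference _ _

variable [Fintype B] [Fintype C]

theorem relabel_liabilityTo (S : FinancialNetwork B) (e : B ≃ C) (r : C → ℝ) (u v : C) :
    (S.relabel e).liabilityTo r u v = S.liabilityTo (r ∘ e) (e.symm u) (e.symm v) := by
  simp only [liabilityTo, relabel]
  rw [← Equiv.sum_comp e]
  simp

theorem relabel_newRate (S : FinancialNetwork B) (e : B ≃ C) (r : C → ℝ) (v : C) :
    (S.relabel e).newRate r v = S.newRate (r ∘ e) (e.symm v) := by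
  have hl : (S.relabel e).liability r v = S.liability (r ∘ e) (e.symm v) := by
    simp only [liability, relabel_liabilityTo]
    rw [← Equiv.sum_comp e]
    simp
  have ha : (S.relabel e).assets r v = S.assets (r ∘ e) (e.symm v) := by
    simp only [assets, payment, relabel_liabilityTo]
    rw [← Equiv.sum_comp e]
    simp [relabel]
  rw [newRate, newRate, hl, ha]

theorem relabel_stable_iff (S : FinancialNetwork B) (e : B ≃ C) (r : C → ℝ) :
    (S.relabel e).Stable r ↔ S.Stable (r ∘ e) := by
  simp only [Stable, Updatable, relabel_newRate]
  rw [← e.forall_congr_right]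
  simp

variable [DecidableEq B] [DecidableEq C]

theorem relabel_state (S : FinancialNetwork B) (e : B ≃ C) (σ : ℕ → C) (t : ℕ) :
    (S.relabel e).state σ t ∘ e = S.state (e.symm ∘ σ) t := by
  induction t with
  | zero => rfl
  | succ t ih =>
    funext b
    simp only [state, Function.comp_apply, relabel_newRate, ih, Function.update_apply,
      Equiv.eq_symm_apply]
    rw [← ih, Function.comp_apply]

theorem IsOrdering.of_relabel {S : FinancialNetwork B} {e : B ≃ C} {σ : ℕ → C}
    (h : (S.relabel e).IsOrdering σ) : S.IsOrdering (e.symm ∘ σ) := by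
  intro t ht
  have := h t (by rwa [relabel_stable_iff, relabel_state])
  rw [Updatable, relabel_newRate, relabel_state] at this
  rw [Updatable, ← relabel_state] at *
  simpa using this

theorem relabel_stabilizesAfter {S : FinancialNetwork B} {e : B ≃ C} {σ : ℕ → C} {T : ℕ}
    (h : S.StabilizesAfter (e.symm ∘ σ) T) : (S.relabel e).StabilizesAfter σ T := by
  simpa only [StabilizesAfter, relabel_stable_iff, relabel_state] using h

end Relabel

/-! ### Runs without a choice -/

section ForcedRun

variable {B : Type*} [Fintype B] [DecidableEq B]

/-- `S.ForcedRun r T`: from the state `r`, the network `S` makes `T` steps before it is stable, and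
before each of them exactly one bank is updatable. -/
inductive ForcedRun (S : FinancialNetwork B) : (B → ℝ) → ℕ → Prop
  | stable {r : B → ℝ} (h : ∀ u, r u = S.newRate r u) : ForcedRun S r 0
  | step {r : B → ℝ} {T : ℕ} (v : B) (hv : r v ≠ S.newRate r v)
      (h : ∀ u, u ≠ v → r u = S.newRate r u)
      (next : ForcedRun S (Function.update r v (S.newRate r v)) T) : ForcedRun S r (T + 1)

theorem ForcedRun.stabilizes {S : FinancialNetwork B} {r : B → ℝ} {T : ℕ} (h : S.ForcedRun r T)
    {σ : ℕ → B} (hσ : S.IsOrdering σ) (t₀ : ℕ) (h₀ : S.state σ t₀ = r) :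
    S.Stable (S.state σ (t₀ + T)) ∧ ∀ t < T, ¬ S.Stable (S.state σ (t₀ + t)) := by
  induction h generalizing t₀ with
  | stable h => exact ⟨fun v => by simp [Updatable, h₀, ← h v], by simp⟩
  | @step r T v hv h _ ih =>
    have hns : ¬ S.Stable (S.state σ t₀) := fun hs => hs v (by rwa [Updatable, h₀])
    have hup := hσ t₀ hns
    have hσv : σ t₀ = v := by
      by_contra hne
      rw [Updatable, h₀] at hup
      exact hup (h _ hne)
    obtain ⟨h1, h2⟩ := ih (t₀ + 1) (by rw [state, h₀, hσv])
    refine ⟨by rwa [Nat.add_right_comm] at h1, fun t ht => ?_⟩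
    cases t with
    | zero => exact hns
    | succ t =>
      have := h2 t (by omega)
      rwa [Nat.add_right_comm] at this

theorem ForcedRun.stabilizesAfter {S : FinancialNetwork B} {T : ℕ}
    (h : S.ForcedRun (fun _ => 1) T) {σ : ℕ → B} (hσ : S.IsOrdering σ) :
    S.StabilizesAfter σ T := by
  simpa [StabilizesAfter] using h.stabilizes hσ 0 rfl

end ForcedRun

end FinancialNetwork

namespace SlowNetwork

open FinancialNetwork

theorem recoveryRate_zero_right {a : ℝ} (ha : 0 ≤ a) : recoveryRate a 0 = 1 := by
  simp [recoveryRate, ha]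

theorem recoveryRate_zero_left {l : ℝ} (hl : 0 < l) : recoveryRate 0 l = 0 := by
  simp [recoveryRate, hl]

theorem recoveryRate_one_right (a : ℝ) : recoveryRate a 1 = min 1 a := by
  unfold recoveryRate
  split_ifs with h
  · exact (min_eq_left h).symm
  · rw [min_eq_right (le_of_not_ge h), div_one]

theorem recoveryRate_of_le {a l : ℝ} (h : a ≤ l) (hl : 0 < l) : recoveryRate a l = a / l := by
  unfold recoveryRate
  split_ifs with h'
  · rw [le_antisymm h h', div_self hl.ne']
  · rfl

/-! ### The slow network -/

/-- The banks of the slow network: a chain of `m + 2` banks, which creates the payment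
`2 ^ (-(m + 1))`; the banks `up` and `down`, which climb in steps of this size; the banks `gate` and
`latch`, which make `up` and `down` react to each other only from the right moment on; a `source`
which can always pay its swaps, and a `sink` without liabilities. -/
inductive Bank (m : ℕ) where
  | chain (i : Fin (m + 2))
  | gate
  | up
  | down
  | latch
  | source
  | sink
  deriving DecidableEq

variable {m : ℕ}

/-- The banks are counted as the chain together with six more banks. -/
def bankEquiv (m : ℕ) : Fin (m + 2) ⊕ Fin 6 ≃ Bank m where
  toFun
    | .inl i => .chain i
    | .inr 0 => .gate
    | .inr 1 => .up
    | .inr 2 => .down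
    | .inr 3 => .latch
    | .inr 4 => .source
    | .inr 5 => .sink
  invFun
    | .chain i => .inl i
    | .gate => .inr 0
    | .up => .inr 1
    | .down => .inr 2
    | .latch => .inr 3
    | .source => .inr 4
    | .sink => .inr 5
  left_inv := by
    rintro (i | i)
    · rfl
    · fin_cases i <;> rfl
  right_inv := by rintro (i | _) <;> rfl

instance : Fintype (Bank m) := Fintype.ofEquiv _ (bankEquiv m)

theorem card_bank (m : ℕ) : Fintype.card (Bank m) = m + 8 := by
  rw [← Fintype.card_congr (bankEquiv m)]
  simp

theorem sum_bank (f : Bank m → ℝ) :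
    ∑ b, f b =
      ∑ i, f (.chain i) + (f .gate + f .up + f .down + f .latch + f .source + f .sink) := by
  rw [← Equiv.sum_comp (bankEquiv m), Fintype.sum_sum_type, Fin.sum_univ_six]
  rfl

/-- The credit default swaps of the slow network, with arguments debtor, creditor and reference
entity. A debtor without a loan owes nothing, and keeps its rate `1`, until one of its reference
entities defaults. Each bank of the chain passes one half of what it owes on to the
next bank of the chain (the last one to `up`) and the other half to the sink. -/
def swap : Bank m → Bank m → Bank m → ℝ
  | .chain i, .chain j, .chain k => if (k : ℕ) + 1 = i ∧ (i : ℕ) + 1 = j then 1 else 0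
  | .chain i, .up, .chain k => if (k : ℕ) + 1 = i ∧ (i : ℕ) = m + 1 then 1 else 0
  | .chain i, .sink, .chain k => if (k : ℕ) + 1 = i then 1 else 0
  | .gate, .sink, .chain k => if (k : ℕ) = m + 1 then 1 else 0
  | .up, .sink, .gate => 1
  | .down, .sink, .latch => 1
  | .latch, .sink, .up => 1
  | .latch, .sink, .down => 1
  | .source, .up, .down => 1
  | .source, .down, .up => 1
  | _, _, _ => 0

/-- The only simple debt, of weight `1`, is that of the first bank of the chain to the sink. -/
def loan : Bank m → Bank m → ℝ
  | .chain i, .sink => if (i : ℕ) = 0 then 1 else 0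
  | _, _ => 0

/-- External assets: `1` for the second bank of the chain and `2` for the source, which
owes at most that much. -/
def wealth : Bank m → ℝ
  | .chain i => if (i : ℕ) = 1 then 1 else 0
  | .source => 2
  | _ => 0

/-- The slow network, with the contracts `loan` and `swap`. All contracts have weight `1`. -/
def slowNetwork (m : ℕ) : FinancialNetwork (Bank m) where
  extAssets := wealth
  debt := loan
  cds := swap
  extAssets_nonneg v := by cases v <;> simp only [wealth] <;> (try split_ifs) <;> norm_num
  debt_nonneg u v := by cases u <;> cases v <;> simp only [loan] <;> (try split_ifs) <;> norm_num
  cds_nonneg u v w := by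
    cases u <;> cases v <;> cases w <;> simp only [swap] <;> (try split_ifs) <;> norm_num
  debt_self u := by cases u <;> rfl
  cds_debtor_eq_creditor u w := by cases u <;> cases w <;> simp [swap]
  cds_debtor_eq_reference u v := by cases u <;> cases v <;> simp [swap]
  cds_creditor_eq_reference u v := by
    cases u <;> cases v <;> simp [swap]
    omega

/-- A state in which the `i`-th bank of the chain has the rate `c i`, the source and the sink have
the rate `1`, and the four remaining banks have the given rates. -/
def rates (c : ℕ → ℝ) (g p q l : ℝ) : Bank m → ℝ
  | .chain i => c i
  | .gate => g
  | .up => p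
  | .down => q
  | .latch => l
  | .source => 1
  | .sink => 1

/-! ### The rates announced in the slow network -/

theorem sum_ite_eq_val (f : ℕ → ℝ) {n i : ℕ} (hi : i < n) :
    ∑ k : Fin n, (if (k : ℕ) = i then f k else 0) = f i := by
  rw [Finset.sum_eq_single ⟨i, hi⟩]
  · simp
  · intro k _ hk
    exact if_neg fun h => hk (Fin.ext h)
  · simp

theorem sum_ite_succ_eq_and (f : ℕ → ℝ) {n i : ℕ} (hi : i ≤ n) (P : Prop) [Decidable P] :
    ∑ k : Fin n, (if (k : ℕ) + 1 = i ∧ P then f k else 0) =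
      if i ≠ 0 ∧ P then f (i - 1) else 0 := by
  rcases i with _ | i
  · simp
  · by_cases hP : P
    · simpa [hP] using sum_ite_eq_val f hi
    · simp [hP]

section NewRate

variable (c : ℕ → ℝ) (g p q l : ℝ)

theorem newRate_gate : (slowNetwork m).newRate (rates c g p q l) .gate =
    recoveryRate 0 (1 - c (m + 1)) := by
  have := sum_ite_eq_val (fun k => 1 - c k) (Nat.lt_succ_self (m + 1))
  simp [newRate, assets, liability, payment, liabilityTo, sum_bank, slowNetwork, swap, loan, wealth,
    rates, this]

theorem newRate_latch : (slowNetwork m).newRate (rates c g p q l) .latch =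
    recoveryRate 0 ((1 - p) + (1 - q)) := by
  simp [newRate, assets, liability, payment, liabilityTo, sum_bank, slowNetwork, swap, loan, wealth,
    rates]

theorem newRate_down : (slowNetwork m).newRate (rates c g p q l) .down =
    recoveryRate (1 - p) (1 - l) := by
  simp [newRate, assets, liability, payment, liabilityTo, sum_bank, slowNetwork, swap, loan, wealth,
    rates]

theorem newRate_source : (slowNetwork m).newRate (rates c g p q l) .source =
    recoveryRate 2 ((1 - q) + (1 - p)) := by
  simp [newRate, assets, liability, payment, liabilityTo, sum_bank, slowNetwork, swap, loan, wealth,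
    rates]

theorem liabilityTo_chain_chain (i j : Fin (m + 2)) :
    (slowNetwork m).liabilityTo (rates c g p q l) (.chain i) (.chain j) =
      if (i : ℕ) ≠ 0 ∧ (i : ℕ) + 1 = j then 1 - c (i - 1) else 0 := by
  rw [← sum_ite_succ_eq_and (fun k => 1 - c k) i.2.le]
  simp [liabilityTo, sum_bank, slowNetwork, swap, loan, rates]

theorem liabilityTo_chain_up (i : Fin (m + 2)) :
    (slowNetwork m).liabilityTo (rates c g p q l) (.chain i) .up =
      if (i : ℕ) = m + 1 then 1 - c m else 0 := by
  have := sum_ite_succ_eq_and (fun k => 1 - c k) i.2.le ((i : ℕ) = m + 1)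
  simp only [liabilityTo, sum_bank, slowNetwork, swap, loan, rates, ite_mul, one_mul, zero_mul,
    this]
  by_cases h : (i : ℕ) = m + 1 <;> simp [h]

theorem liabilityTo_chain_sink (i : Fin (m + 2)) :
    (slowNetwork m).liabilityTo (rates c g p q l) (.chain i) .sink =
      if (i : ℕ) = 0 then 1 else 1 - c (i - 1) := by
  have := sum_ite_succ_eq_and (fun k => 1 - c k) i.2.le True
  simp only [and_true] at this
  simp only [liabilityTo, sum_bank, slowNetwork, swap, loan, rates, ite_mul, one_mul, zero_mul,
    this]
  by_cases h : (i : ℕ) = 0 <;> simp [h]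

theorem newRate_sink : (slowNetwork m).newRate (rates c g p q l) .sink =
    recoveryRate ((slowNetwork m).assets (rates c g p q l) .sink) 0 := by
  simp [newRate, liability, liabilityTo, slowNetwork, swap, loan]

theorem newRate_up : (slowNetwork m).newRate (rates c g p q l) .up =
    recoveryRate (c (m + 1) * (1 - c m) + (1 - q)) (1 - g) := by
  have h := sum_ite_eq_val (fun k => c k * (1 - c m)) (Nat.lt_succ_self (m + 1))
  rw [newRate]
  congr 1
  · simp only [assets, payment, sum_bank, liabilityTo_chain_up]
    simp [liabilityTo, sum_bank, slowNetwork, swap, loan, wealth, rates, h]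
  · simp [liability, liabilityTo, sum_bank, slowNetwork, swap, loan, rates]

theorem liability_chain (i : Fin (m + 2)) :
    (slowNetwork m).liability (rates c g p q l) (.chain i) =
      if (i : ℕ) = 0 then 1 else 2 * (1 - c (i - 1)) := by
  simp only [liability, sum_bank, liabilityTo_chain_chain, liabilityTo_chain_up,
    liabilityTo_chain_sink]
  have h0 : ∀ v : Bank m, v = .gate ∨ v = .down ∨ v = .latch ∨ v = .source →
      (slowNetwork m).liabilityTo (rates c g p q l) (.chain i) v = 0 := by
    rintro v (rfl | rfl | rfl | rfl) <;> simp [liabilityTo, slowNetwork, swap, loan]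
  simp only [h0, true_or, or_true]
  by_cases hi : (i : ℕ) = 0
  · simp [hi]
  by_cases hm : (i : ℕ) = m + 1
  · rw [Finset.sum_eq_zero fun k _ => if_neg fun h => by have := k.2; omega]
    simp [hm]
    ring
  · have := sum_ite_eq_val (fun _ => 1 - c (i - 1)) (i := (i : ℕ) + 1) (n := m + 2) (by omega)
    simp only [eq_comm (a := (i : ℕ) + 1), ne_eq, hi, not_false_iff, true_and, this, hm, if_false]
    ring

theorem assets_chain (i : Fin (m + 2)) :
    (slowNetwork m).assets (rates c g p q l) (.chain i) =
      if (i : ℕ) = 0 then 0 else if (i : ℕ) = 1 then 1 else c (i - 1) * (1 - c (i - 2)) := by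
  have h0 : ∀ v : Bank m, (∀ k, v ≠ .chain k) →
      (slowNetwork m).liabilityTo (rates c g p q l) v (.chain i) = 0 := by
    intro v hv
    cases v <;> simp [liabilityTo, slowNetwork, swap, loan] at *
  have hsum : ∑ k : Fin (m + 2), c k * (if (k : ℕ) ≠ 0 ∧ (k : ℕ) + 1 = i then 1 - c (k - 1) else 0)
      = if (i : ℕ) = 0 ∨ (i : ℕ) = 1 then 0 else c (i - 1) * (1 - c (i - 2)) := by
    obtain ⟨_ | _ | i, hi⟩ := i
    · simp
    · simp
    · have := sum_ite_eq_val (fun k => c k * (1 - c (k - 1))) (n := m + 2) (i := i + 1) (by omega)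
      simp only [Nat.add_sub_cancel] at this
      simp only [Nat.add_eq_zero_iff, one_ne_zero, and_false, Nat.add_eq_right, or_self, if_false,
        Nat.add_sub_cancel]
      rw [show i + 1 + 1 - 2 = i by omega, ← this]
      refine Finset.sum_congr rfl fun k _ => ?_
      by_cases hk : (k : ℕ) = i + 1 <;> simp [hk]
  simp only [assets, payment, sum_bank, liabilityTo_chain_chain]
  rw [h0 _ (by simp), h0 _ (by simp), h0 _ (by simp), h0 _ (by simp), h0 _ (by simp),
    h0 _ (by simp)]
  simp only [rates, hsum, slowNetwork, wealth]
  split_ifs <;> first | omega | simp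

theorem newRate_chain (i : Fin (m + 2)) :
    (slowNetwork m).newRate (rates c g p q l) (.chain i) =
      recoveryRate (if (i : ℕ) = 0 then 0 else if (i : ℕ) = 1 then 1
        else c (i - 1) * (1 - c (i - 2))) (if (i : ℕ) = 0 then 1 else 2 * (1 - c (i - 1))) := by
  rw [newRate, assets_chain, liability_chain]

theorem assets_sink_nonneg (hc : ∀ i, 0 ≤ c i ∧ c i ≤ 1) (hg : 0 ≤ g ∧ g ≤ 1)
    (hp : 0 ≤ p ∧ p ≤ 1) (hq : 0 ≤ q ∧ q ≤ 1) (hl : 0 ≤ l ∧ l ≤ 1) :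
    0 ≤ (slowNetwork m).assets (rates c g p q l) .sink := by
  have hr : ∀ b : Bank m, 0 ≤ rates c g p q l b ∧ rates c g p q l b ≤ 1 := by
    intro b
    cases b <;> simp_all [rates]
  refine add_nonneg ((slowNetwork m).extAssets_nonneg _) (Finset.sum_nonneg fun u _ => ?_)
  refine mul_nonneg (hr u).1 (add_nonneg ((slowNetwork m).debt_nonneg _ _) ?_)
  exact Finset.sum_nonneg fun w _ =>
    mul_nonneg ((slowNetwork m).cds_nonneg _ _ _) (sub_nonneg.2 (hr w).2)

end NewRate

/-! ### The chain -/

/-- The rate at which the `i`-th bank of the chain, counted from `0`, settles. For `i ≥ 1` this bank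
then has the assets `2 ^ (-(i - 1))`, and owes `1 - settled (i - 1)` to each of two creditors. -/
noncomputable def settled : ℕ → ℝ
  | 0 => 0
  | i + 1 => (1 / 2) ^ i / (2 * (1 - settled i))

theorem settled_mem (i : ℕ) : 0 ≤ settled i ∧ settled i ≤ 1 / 2 := by
  induction i with
  | zero => norm_num [settled]
  | succ i ih =>
    have hpos : 0 < 2 * (1 - settled i) := by linarith
    refine ⟨div_nonneg (by positivity) hpos.le, ?_⟩
    rcases i with _ | i
    · norm_num [settled]
    · have h2 : (1 / 2 : ℝ) ^ (i + 1) ≤ 1 / 2 := by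
        rw [pow_succ]
        have : (1 / 2 : ℝ) ^ i ≤ 1 := pow_le_one₀ (by norm_num) (by norm_num)
        linarith
      rw [settled, div_le_iff₀ hpos]
      linarith

/-- In the settled chain, the `(i + 1)`-st bank pays `2 ^ (-(i + 1))` to its successor. -/
theorem settled_succ_mul (i : ℕ) : settled (i + 1) * (1 - settled i) = (1 / 2) ^ (i + 1) := by
  have := settled_mem i
  have h : 1 - settled i ≠ 0 := by linarith
  rw [settled]
  field_simp
  rw [pow_succ]
  ring

theorem recoveryRate_settled (i : ℕ) :
    recoveryRate ((1 / 2) ^ i) (2 * (1 - settled i)) = settled (i + 1) := by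
  have := settled_mem i
  have h1 : (1 / 2 : ℝ) ^ i ≤ 1 := pow_le_one₀ (by norm_num) (by norm_num)
  rw [recoveryRate_of_le (by linarith) (by linarith), settled]

/-- The rates in the chain when its first `j` banks have settled. -/
noncomputable def partlySettled (j i : ℕ) : ℝ := if i < j then settled i else 1

theorem partlySettled_mem (j i : ℕ) : 0 ≤ partlySettled j i ∧ partlySettled j i ≤ 1 := by
  have := settled_mem i
  unfold partlySettled
  split_ifs <;> constructor <;> linarith

/-- When `j` banks of the chain have settled, the next one is the only bank of the chain
to be updatable. -/
theorem newRate_chain_partlySettled (j : ℕ) (g p q l : ℝ) (i : Fin (m + 2)) :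
    (slowNetwork m).newRate (rates (partlySettled j) g p q l) (.chain i) =
      partlySettled (j + 1) i := by
  rw [newRate_chain]
  obtain ⟨_ | _ | i, hi⟩ := i
  · simpa [partlySettled, settled] using recoveryRate_zero_left one_pos
  · have := recoveryRate_settled 0
    rw [pow_zero] at this
    by_cases h : 0 < j
    · simpa [partlySettled, h] using this
    · simpa [partlySettled, h] using recoveryRate_zero_right zero_le_one
  · simp only [Nat.add_eq_zero_iff, one_ne_zero, and_false, Nat.add_eq_right, if_false,
      Nat.add_sub_cancel]
    rw [show i + 1 + 1 - 2 = i by omega]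
    by_cases h : i + 1 < j
    · rw [partlySettled, partlySettled, partlySettled, if_pos h, if_pos (by omega),
        if_pos (by omega), settled_succ_mul, recoveryRate_settled]
    · have h1 : partlySettled j (i + 1) = 1 := if_neg h
      have h2 : partlySettled (j + 1) (i + 1 + 1) = 1 := if_neg (by omega)
      have h3 := (partlySettled_mem j i).2
      rw [h1, h2, sub_self, mul_zero, recoveryRate_zero_right (by linarith)]

theorem newRate_up_partlySettled (g p q l : ℝ) :
    (slowNetwork m).newRate (rates (partlySettled (m + 2)) g p q l) .up =
      recoveryRate ((1 / 2) ^ (m + 1) + (1 - q)) (1 - g) := by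
  rw [newRate_up, partlySettled, partlySettled, if_pos (by omega), if_pos (by omega),
    settled_succ_mul]

theorem newRate_source_of_mem (c : ℕ → ℝ) (g l : ℝ) {p q : ℝ} (hp : 0 ≤ p) (hq : 0 ≤ q) :
    (slowNetwork m).newRate (rates c g p q l) .source = 1 := by
  rw [newRate_source, recoveryRate, if_pos (by linarith)]

theorem newRate_sink_of_mem (j : ℕ) {g p q l : ℝ} (hg : 0 ≤ g ∧ g ≤ 1)
    (hp : 0 ≤ p ∧ p ≤ 1) (hq : 0 ≤ q ∧ q ≤ 1) (hl : 0 ≤ l ∧ l ≤ 1) :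
    (slowNetwork m).newRate (rates (partlySettled j) g p q l) .sink = 1 := by
  rw [newRate_sink]
  exact recoveryRate_zero_right (assets_sink_nonneg _ _ _ _ _ (partlySettled_mem j) hg hp hq hl)

section Update

variable (c : ℕ → ℝ) (g p q l y : ℝ)

theorem update_gate : Function.update (rates c g p q l : Bank m → ℝ) .gate y =
    rates c y p q l := by
  funext b; cases b <;> simp [rates]

theorem update_up : Function.update (rates c g p q l : Bank m → ℝ) .up y =
    rates c g y q l := by
  funext b; cases b <;> simp [rates]

theorem update_down : Function.update (rates c g p q l : Bank m → ℝ) .down y =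
    rates c g p y l := by
  funext b; cases b <;> simp [rates]

theorem update_latch : Function.update (rates c g p q l : Bank m → ℝ) .latch y =
    rates c g p q y := by
  funext b; cases b <;> simp [rates]

theorem update_chain (j : Fin (m + 2)) :
    Function.update (rates (partlySettled j) g p q l : Bank m → ℝ) (.chain j)
      (partlySettled (j + 1) j) = rates (partlySettled (j + 1)) g p q l := by
  funext b
  cases b with
  | chain i =>
    by_cases h : i = j
    · simp [h, rates]
    · have : (i : ℕ) ≠ j := fun h' => h (Fin.ext h')
      have h2 : (i : ℕ) < j + 1 ↔ (i : ℕ) < j := by omega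
      simp [h, rates, partlySettled, h2]
  | _ => simp [rates]

end Update

/-! ### The forced run -/

/-- The state after the start, in which the chain, the gate and the latch have settled. -/
noncomputable abbrev climbing (m : ℕ) (p q : ℝ) : Bank m → ℝ :=
  rates (partlySettled (m + 2)) 0 p q 0

/-- While `up` and `down` move, only these two banks can be updatable. The hypothesis `hpq` keeps
the latch in default, also when `up` is back at the rate `1`. -/
theorem climbing_eq_newRate {p q : ℝ} (hp : 0 ≤ p ∧ p ≤ 1) (hq : 0 ≤ q ∧ q ≤ 1)
    (hpq : p < 1 ∨ q < 1) {u : Bank m} (hu : u ≠ .up) (hd : u ≠ .down) :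
    climbing m p q u = (slowNetwork m).newRate (climbing m p q) u := by
  have h01 : (0 : ℝ) ≤ 0 ∧ (0 : ℝ) ≤ 1 := by norm_num
  cases u with
  | chain i =>
    rw [newRate_chain_partlySettled]
    have h1 := i.2
    simp [rates, partlySettled]
  | gate =>
    have := settled_mem (m + 1)
    rw [newRate_gate, recoveryRate_zero_left]
    · rfl
    · rw [partlySettled, if_pos (by omega)]
      linarith
  | up => exact absurd rfl hu
  | down => exact absurd rfl hd
  | latch =>
    rw [newRate_latch, recoveryRate_zero_left]
    · rfl
    · rcases hpq with h | h <;> linarith [hp.2, hq.2]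
  | source => exact (newRate_source_of_mem _ _ _ hp.1 hq.1).symm
  | sink => exact (newRate_sink_of_mem _ h01 hp hq h01).symm

theorem newRate_climbing_up (p q : ℝ) :
    (slowNetwork m).newRate (climbing m p q) .up = min 1 ((1 / 2) ^ (m + 1) + (1 - q)) := by
  rw [newRate_up_partlySettled, sub_zero, recoveryRate_one_right]

theorem newRate_climbing_down (p q : ℝ) :
    (slowNetwork m).newRate (climbing m p q) .down = min 1 (1 - p) := by
  rw [newRate_down, sub_zero, recoveryRate_one_right]

/-- From the moment at which `up` has the rate `1 - j ε` with `ε = 2 ^ (-(m + 1))`, and `down` has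
not yet reacted to that, `2 j + 1` steps are left. -/
theorem forcedRun_climbing (m j : ℕ) (hj : j < 2 ^ (m + 1)) :
    (slowNetwork m).ForcedRun
      (climbing m (1 - j * (1 / 2) ^ (m + 1)) ((j + 1) * (1 / 2) ^ (m + 1))) (2 * j + 1) := by
  induction j using Nat.strong_induction_on with | _ j ih => ?_
  set ε : ℝ := (1 / 2) ^ (m + 1) with hε
  have hε0 : 0 < ε := by positivity
  have hε1 : (2 : ℝ) ^ (m + 1) * ε = 1 := by
    rw [hε, ← mul_pow]
    norm_num
  have hjε : ((j : ℝ) + 1) * ε ≤ 1 := by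
    refine le_of_le_of_eq ?_ hε1
    have : (j : ℝ) + 1 ≤ 2 ^ (m + 1) := by exact_mod_cast hj
    exact mul_le_mul_of_nonneg_right this hε0.le
  have hj0 : 0 ≤ (j : ℝ) * ε := by positivity
  have hp : 0 ≤ 1 - j * ε ∧ 1 - j * ε ≤ 1 := ⟨by linarith, by linarith⟩
  have hdown : (slowNetwork m).newRate (climbing m (1 - j * ε) ((j + 1) * ε)) .down = j * ε := by
    rw [newRate_climbing_down, min_eq_right] <;> linarith
  have hlt : (j : ℝ) * ε < 1 := by linarith
  -- For `j = 0` this is where `ε < 1` is needed: `down` has not been updated yet, and its rate `ε`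
  -- alone keeps the latch in default.
  have hlow : (1 - j * ε < 1 ∨ (j + 1) * ε < 1) := by
    rcases j with _ | j
    · right
      have : (2 : ℝ) ≤ 2 ^ (m + 1) := le_self_pow₀ one_le_two (by omega)
      push_cast
      nlinarith
    · left
      have : 0 < ((j + 1 : ℕ) : ℝ) * ε := by positivity
      linarith
  refine .step .down ?_ (fun u hu => ?_) ?_
  · rw [hdown]
    simp only [rates]
    linarith
  · by_cases hu' : u = .up
    · subst hu'
      rw [newRate_climbing_up, ← hε, min_eq_right (by linarith)]
      simp only [rates]
      linarith
    · exact climbing_eq_newRate hp ⟨by linarith, hjε⟩ hlow hu' hu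
  rw [hdown, update_down]
  have hup : (slowNetwork m).newRate (climbing m (1 - j * ε) (j * ε)) .up =
      min 1 (ε + (1 - j * ε)) := newRate_climbing_up _ _
  have hrest : ∀ u : Bank m, u ≠ .up → climbing m (1 - j * ε) (j * ε) u =
      (slowNetwork m).newRate (climbing m (1 - j * ε) (j * ε)) u := by
    intro u hu
    by_cases hu' : u = .down
    · subst hu'
      rw [newRate_climbing_down, min_eq_right (by linarith)]
      simp only [rates]
      linarith
    · exact climbing_eq_newRate hp ⟨hj0, hlt.le⟩ (.inr hlt) hu hu'
  rcases j with _ | j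
  · refine .stable fun u => ?_
    by_cases hu : u = .up
    · subst hu
      rw [hup, min_eq_left] <;> simp [rates, hε0.le]
    · exact hrest u hu
  · have hup' : (slowNetwork m).newRate (climbing m (1 - (j + 1 : ℕ) * ε) ((j + 1 : ℕ) * ε)) .up =
        1 - j * ε := by
      have : 0 ≤ (j : ℝ) * ε := by positivity
      rw [hup, min_eq_right] <;> push_cast <;> linarith
    refine .step .up ?_ hrest ?_
    · rw [hup']
      simp only [rates]
      push_cast
      linarith
    · rw [hup', update_up]
      exact_mod_cast ih j (by omega) (by omega)

/-- When the chain has settled, the next updates are those of `gate`, `up` and `latch`, in this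
order: `down` owes nothing before `latch` defaults, which it does only after `up` has dropped. -/
theorem forcedRun_gate (m : ℕ) :
    (slowNetwork m).ForcedRun (rates (partlySettled (m + 2)) 1 1 1 1) (2 * 2 ^ (m + 1) + 2) := by
  have h01 : (0 : ℝ) ≤ 0 ∧ (0 : ℝ) ≤ 1 := by norm_num
  have h11 : (0 : ℝ) ≤ 1 ∧ (1 : ℝ) ≤ 1 := by norm_num
  have hchain : ∀ (g p q l : ℝ) (i : Fin (m + 2)),
      (rates (partlySettled (m + 2)) g p q l : Bank m → ℝ) (.chain i) =
        (slowNetwork m).newRate (rates (partlySettled (m + 2)) g p q l) (.chain i) := by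
    intro g p q l i
    rw [newRate_chain_partlySettled]
    have h1 := i.2
    rw [rates, partlySettled, partlySettled, if_pos h1, if_pos (by omega)]
  have hgate : ∀ g p q l : ℝ,
      (slowNetwork m).newRate (rates (partlySettled (m + 2)) g p q l) .gate = 0 := by
    intro g p q l
    have := settled_mem (m + 1)
    rw [newRate_gate, recoveryRate_zero_left]
    rw [partlySettled, if_pos (by omega)]
    linarith
  set ε : ℝ := (1 / 2) ^ (m + 1) with hε
  have hε0 : 0 < ε := by positivity
  have hε1 : ε < 1 := pow_lt_one₀ (by norm_num) (by norm_num) (by omega)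
  have hεε : (0 : ℝ) ≤ ε ∧ ε ≤ 1 := ⟨hε0.le, hε1.le⟩
  refine .step .gate ?_ (fun u hu => ?_) ?_
  · rw [hgate]
    exact one_ne_zero
  · cases u with
    | chain i => exact hchain _ _ _ _ i
    | gate => exact absurd rfl hu
    | up => rw [newRate_up_partlySettled, sub_self, recoveryRate_zero_right (by linarith)]; rfl
    | down => rw [newRate_down, sub_self, recoveryRate_zero_right le_rfl]; rfl
    | latch => rw [newRate_latch, sub_self, add_zero, recoveryRate_zero_right le_rfl]; rfl
    | source => exact (newRate_source_of_mem _ _ _ zero_le_one zero_le_one).symm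
    | sink => exact (newRate_sink_of_mem _ h11 h11 h11 h11).symm
  rw [hgate, update_gate]
  have hup : ∀ p l, (slowNetwork m).newRate (rates (partlySettled (m + 2)) 0 p 1 l) .up = ε := by
    intro p l
    rw [newRate_up_partlySettled, sub_self, sub_zero, add_zero, recoveryRate_one_right,
      min_eq_right hε1.le]
  refine .step .up ?_ (fun u hu => ?_) ?_
  · rw [hup]
    exact hε1.ne'
  · cases u with
    | chain i => exact hchain _ _ _ _ i
    | gate => exact (hgate _ _ _ _).symm
    | up => exact absurd rfl hu
    | down => rw [newRate_down, sub_self, recoveryRate_zero_right le_rfl]; rfl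
    | latch => rw [newRate_latch, sub_self, add_zero, recoveryRate_zero_right le_rfl]; rfl
    | source => exact (newRate_source_of_mem _ _ _ zero_le_one zero_le_one).symm
    | sink => exact (newRate_sink_of_mem _ h01 h11 h11 h11).symm
  rw [hup, update_up]
  have hlatch : (slowNetwork m).newRate (rates (partlySettled (m + 2)) 0 ε 1 1) .latch = 0 := by
    rw [newRate_latch, recoveryRate_zero_left]
    linarith
  obtain ⟨k, hk⟩ : ∃ k, 2 ^ (m + 1) = k + 1 :=
    Nat.exists_eq_succ_of_ne_zero (pow_ne_zero _ two_ne_zero)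
  rw [hk, show 2 * (k + 1) = 2 * k + 1 + 1 by ring]
  refine .step .latch ?_ (fun u hu => ?_) ?_
  · rw [hlatch]
    exact one_ne_zero
  · cases u with
    | chain i => exact hchain _ _ _ _ i
    | gate => exact (hgate _ _ _ _).symm
    | up => exact (hup _ _).symm
    | down => rw [newRate_down, sub_self, recoveryRate_zero_right (by linarith)]; rfl
    | latch => exact absurd rfl hu
    | source => exact (newRate_source_of_mem _ _ _ hε0.le zero_le_one).symm
    | sink => exact (newRate_sink_of_mem _ h01 hεε h11 h11).symm
  rw [hlatch, update_latch]
  have hone : ((k : ℝ) + 1) * ε = 1 := by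
    have : (2 : ℝ) ^ (m + 1) = k + 1 := by exact_mod_cast hk
    rw [← this, hε, ← mul_pow]
    norm_num
  have := forcedRun_climbing m k (by omega)
  rwa [← hε, hone, show 1 - (k : ℝ) * ε = ε by linarith] at this

theorem forcedRun_chain (m j : ℕ) (hj : j ≤ m + 2) :
    (slowNetwork m).ForcedRun (rates (partlySettled (m + 2 - j)) 1 1 1 1)
      (2 * 2 ^ (m + 1) + 2 + j) := by
  have h11 : (0 : ℝ) ≤ 1 ∧ (1 : ℝ) ≤ 1 := by norm_num
  induction j with
  | zero => exact forcedRun_gate m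
  | succ j ih =>
    obtain ⟨i, hi⟩ : ∃ i, i = m + 2 - (j + 1) := ⟨_, rfl⟩
    have hi' : m + 2 - j = i + 1 := by omega
    have him : i < m + 2 := by omega
    have hnew : (slowNetwork m).newRate (rates (partlySettled i) 1 1 1 1) (.chain ⟨i, him⟩) =
        partlySettled (i + 1) i := newRate_chain_partlySettled _ _ _ _ _ _
    rw [← hi]
    refine .step (.chain ⟨i, him⟩) ?_ (fun u hu => ?_) ?_
    · have := settled_mem i
      rw [hnew, rates, partlySettled, partlySettled, if_neg (lt_irrefl _), if_pos (by omega)]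
      linarith
    · cases u with
      | chain k =>
        have hk : (k : ℕ) ≠ i := fun h => hu (by simp [← h])
        have hiff : (k : ℕ) < i + 1 ↔ (k : ℕ) < i := by omega
        rw [newRate_chain_partlySettled]
        simp only [rates, partlySettled, hiff]
      | gate =>
        rw [newRate_gate, partlySettled, if_neg (by omega), sub_self,
          recoveryRate_zero_right le_rfl]
        rfl
      | up =>
        have h1 := partlySettled_mem i (m + 1)
        have h2 := partlySettled_mem i m
        rw [newRate_up, sub_self, add_zero,
          recoveryRate_zero_right (mul_nonneg h1.1 (sub_nonneg.2 h2.2))]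
        rfl
      | down => rw [newRate_down, sub_self, recoveryRate_zero_right le_rfl]; rfl
      | latch => rw [newRate_latch, sub_self, add_zero, recoveryRate_zero_right le_rfl]; rfl
      | source => exact (newRate_source_of_mem _ _ _ zero_le_one zero_le_one).symm
      | sink => exact (newRate_sink_of_mem _ h11 h11 h11 h11).symm
    · rw [hnew, update_chain (j := ⟨i, him⟩), ← hi']
      exact ih (by omega)

theorem forcedRun_slowNetwork (m : ℕ) :
    (slowNetwork m).ForcedRun (fun _ => 1) (2 ^ (m + 2) + m + 4) := by
  have h := forcedRun_chain m (m + 2) le_rfl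
  have h1 : (rates (partlySettled 0) 1 1 1 1 : Bank m → ℝ) = fun _ => 1 := by
    funext b
    cases b <;> simp [rates, partlySettled]
  rw [Nat.sub_self, h1] at h
  convert h using 1
  ring


end SlowNetwork

theorem mainTheorem1 :
    ∃ c : ℝ, 0 < c ∧ ∃ N : ℕ, ∀ n : ℕ, N ≤ n →
      ∃ S : FinancialNetwork (Fin n), ∀ σ : ℕ → Fin n, S.IsOrdering σ →
        ∃ T : ℕ, S.StabilizesAfter σ T ∧ (2 : ℝ) ^ (c * (n : ℝ)) ≤ (T : ℝ) := by
  refine ⟨1 / 2, by norm_num, 12, fun n hn => ?_⟩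
  obtain ⟨m, rfl⟩ : ∃ m, n = m + 8 := ⟨n - 8, by omega⟩
  have e := Fintype.equivFinOfCardEq (SlowNetwork.card_bank m)
  refine ⟨(SlowNetwork.slowNetwork m).relabel e, fun σ hσ => ⟨2 ^ (m + 2) + m + 4, ?_, ?_⟩⟩
  · exact FinancialNetwork.relabel_stabilizesAfter
      ((SlowNetwork.forcedRun_slowNetwork m).stabilizesAfter hσ.of_relabel)
  · have h : (4 : ℝ) ≤ m := by exact_mod_cast (by omega : 4 ≤ m)
    calc (2 : ℝ) ^ ((1 / 2 : ℝ) * ((m + 8 : ℕ) : ℝ)) ≤ (2 : ℝ) ^ ((m + 2 : ℕ) : ℝ) := by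
          refine Real.rpow_le_rpow_of_exponent_le one_le_two ?_
          push_cast
          linarith
      _ = (2 : ℝ) ^ (m + 2) := Real.rpow_natCast _ _
      _ ≤ ((2 ^ (m + 2) + m + 4 : ℕ) : ℝ) := by
          push_cast
          linarith
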